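/- Let $D\ge 1$ and $\ell\ge 2$ be integers. For $n\ge 0$ let $\mathcal F_n$ be the family of $\ell$-adic cubes $\prod_{i=1}^D[k_i\ell^{-n},(k_i+1)\ell^{-n})$, $0\le k_i<\ell^n$, of $[0,1)^D$. Suppose that for every $n$ the cubes in $\mathcal F_n$ are coded bijectively by the words $\varepsilon_1\cdots\varepsilon_n$ over $\{0,\dots,\ell^D-1\}$, in such a way that $I_{\varepsilon_1\cdots\varepsilon_{n+1}}\subset I_{\varepsilon_1\cdots\varepsilon_n}$ always; if $I$ and $J$ are coded by the words $w$ and $v$, let $IJ$ be the cube coded by the concatenation $wv$. Let $m$ be a Borel probability measure on $\mathbb R^D$ with $m([0,1)^D)=1$ which is quasi-Bernoulli: there is a constant $C\ge 1$ with $$\frac1C\,m(I)m(J)\le m(IJ)\le C\,m(I)m(J)\qquad\text{for all } I,J\in\bigcup_n\mathcal F_n .$$ Let $$\tau(q)=\limsup_{n\to\infty}\frac1{n\log\ell}\log\Bigl(\sum_{I\in\mathcal F_n,\ m(I)>0}m(I)^q\Bigr)$$ be its $L^q$-spectrum and $d=-\tau'(1)$. Suppose that there is a real $\sigma\ge 0$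 such that $\tau(1-q)=qd+\frac{\sigma^2}2q^2+o(q^2)$ as $q\to 0$. For small $t>0$ put $$\Theta(t)=\ell^{\sqrt{2\,\log_\ell(1/t)\;\log_\ell\log_\ell\log_\ell(1/t)}} .$$ For a gauge $\Psi$, let $\mathcal H^\Psi$ be the Hausdorff measure on $\mathbb R^D$, $\mathcal H^\Psi(E)=\lim_{\delta\to0}\inf\{\sum_i\Psi(\operatorname{diam}U_i)\}$, the infimum being over countable coverings of $E$ by sets $U_i$ of diameter at most $\delta$ (with $\Psi(0)=\lim_{t\to 0^+}\Psi(t)\in[0,\infty]$, and the empty set contributing $0$); let $\mathcal P^\Psi(E)=\lim_{\delta\to0}\sup\{\sum_i\Psi(2r_i)\}$, the supremum being over families of pairwise disjoint closed balls $B(x_i,r_i)$ with $x_i\in E$ and $0<r_i\le\delta$; and let $\widehat{\mathcal P}^\Psi(E)=\inf\{\sum_i\mathcal P^\Psi(E_i):E\subset\bigcup_{i\in\mathbb N}E_i\}$ be the packing measure. Then, for every $\varepsilon>0$, 1. $m\ll\mathcal H^\Psi$, where $\Psi(t)=t^d\,\Theta(t)^{\sigma+\varepsilon}$; 2. $m\perp\widehat{\mathcal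 P}^\Psi$, where $\Psi(t)=t^d\,\Theta(t)^{-(\sigma+\varepsilon)}$. -/

import Mathlib

open MeasureTheory Filter Topology Asymptotics
open scoped ENNReal

noncomputable section

/-! ### Hausdorff measures with a general gauge -/

/-- The value that a gauge `Ψ`, given on `(0, ∞)`, assigns to a diameter. At a diameter `0`
the gauge is extended by its limit at `0` from the right. -/
def gaugeValue (Ψ : ℝ → ℝ) (r : ℝ≥0∞) : ℝ≥0∞ :=
  if r = 0 then limsup (fun t : ℝ => ENNReal.ofReal (Ψ t)) (𝓝[>] 0)
  else ENNReal.ofReal (Ψ r.toReal)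

/-- The Hausdorff measure `ℋ^Ψ` with gauge `Ψ`: the limit as `δ → 0` of the infimum of
`∑ Ψ (diam U_i)` over countable coverings by sets `U_i` of diameter at most `δ`. -/
def hausdorffGaugeMeasure {X : Type*} [EMetricSpace X] [MeasurableSpace X] [BorelSpace X]
    (Ψ : ℝ → ℝ) : Measure X :=
  Measure.mkMetric (gaugeValue Ψ)

/-! ### Packing measures with a general gauge -/

/-- `P` is a `δ`-packing of `E`: a family of pairwise disjoint closed balls `B(x, r)`,
recorded as pairs `(x, r)`, with centres `x ∈ E` and radii `0 < r ≤ δ`. -/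
structure IsPacking {X : Type*} [MetricSpace X] (δ : ℝ) (E : Set X) (P : Set (X × ℝ)) :
    Prop where
  center_mem : ∀ p ∈ P, p.1 ∈ E
  radius_pos : ∀ p ∈ P, 0 < p.2
  radius_le : ∀ p ∈ P, p.2 ≤ δ
  disjoint : P.PairwiseDisjoint fun p => Metric.closedBall p.1 p.2

/-- The supremum of `∑ Ψ (2 r_i)` over all `δ`-packings `(B(x_i, r_i))` of `E`. -/
def packingSup {X : Type*} [MetricSpace X] (Ψ : ℝ → ℝ) (δ : ℝ) (E : Set X) : ℝ≥0∞ :=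
  ⨆ (P : Set (X × ℝ)) (_ : IsPacking δ E P), ∑' p : P, ENNReal.ofReal (Ψ (2 * p.1.2))

/-- The packing pre-measure `𝒫^Ψ (E)`: the (decreasing) limit of `packingSup Ψ δ E`
as `δ → 0`. -/
def packingPremeasure {X : Type*} [MetricSpace X] (Ψ : ℝ → ℝ) (E : Set X) : ℝ≥0∞ :=
  ⨅ (δ : ℝ) (_ : 0 < δ), packingSup Ψ δ E

theorem packingPremeasure_empty {X : Type*} [MetricSpace X] (Ψ : ℝ → ℝ) :
    packingPremeasure Ψ (∅ : Set X) = 0 := by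
  refine le_antisymm (iInf₂_le_of_le 1 one_pos (iSup₂_le fun P hP => ?_)) bot_le
  have : P = ∅ := Set.eq_empty_of_forall_notMem fun p hp => hP.center_mem p hp
  subst this
  simp

theorem IsPacking.mono {X : Type*} [MetricSpace X] {δ δ' : ℝ} {E E' : Set X}
    {P : Set (X × ℝ)} (h : IsPacking δ E P) (hδ : δ ≤ δ') (hE : E ⊆ E') :
    IsPacking δ' E' P :=
  ⟨fun p hp => hE (h.center_mem p hp), h.radius_pos, fun p hp => (h.radius_le p hp).trans hδ,
    h.disjoint⟩

theorem packingSup_mono {X : Type*} [MetricSpace X] (Ψ : ℝ → ℝ) {δ δ' : ℝ} {E E' : Set X}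
    (hδ : δ ≤ δ') (hE : E ⊆ E') : packingSup Ψ δ E ≤ packingSup Ψ δ' E' :=
  iSup₂_le fun P hP => le_iSup₂_of_le P (hP.mono hδ hE) le_rfl

theorem packingPremeasure_mono {X : Type*} [MetricSpace X] (Ψ : ℝ → ℝ) {E E' : Set X}
    (hE : E ⊆ E') : packingPremeasure Ψ E ≤ packingPremeasure Ψ E' :=
  iInf₂_mono fun _ _ => packingSup_mono Ψ le_rfl hE

theorem packingPremeasure_add_le {X : Type*} [MetricSpace X] (Ψ : ℝ → ℝ) {s t : Set X}
    (h : Metric.AreSeparated s t) :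
    packingPremeasure Ψ s + packingPremeasure Ψ t ≤ packingPremeasure Ψ (s ∪ t) := by
  obtain ⟨r, hr0, hr⟩ := h
  obtain ⟨η, hη0, hη⟩ : ∃ η : ℝ, 0 < η ∧ ENNReal.ofReal (2 * η) < r := by
    obtain ⟨a, ha0, har⟩ := ENNReal.lt_iff_exists_nnreal_btwn.1 (pos_iff_ne_zero.2 hr0)
    refine ⟨a / 2, by simpa using ha0, ?_⟩
    rwa [mul_div_cancel₀ _ (two_ne_zero), ENNReal.ofReal_coe_nnreal]
  refine le_iInf₂ fun δ hδ => ?_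
  have hm : 0 < min δ η := lt_min hδ hη0
  refine le_trans (add_le_add (iInf₂_le _ hm) (iInf₂_le _ hm))
    (le_trans ?_ (packingSup_mono Ψ (min_le_left δ η) le_rfl))
  have hemp : ∀ E : Set X, IsPacking (min δ η) E ∅ := fun E =>
    ⟨by simp, by simp, by simp, by simp⟩
  refine ENNReal.biSup_add_biSup_le' (p := IsPacking (min δ η) s)
    (q := IsPacking (min δ η) t) ⟨∅, hemp s⟩ ⟨∅, hemp t⟩ fun P hP Q hQ => ?_
  have hlt : ∀ p ∈ P, ∀ q ∈ Q, p.2 + q.2 < dist p.1 q.1 := by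
    intro p hp q hq
    have h1 := hr _ (hP.center_mem p hp) _ (hQ.center_mem q hq)
    have h2 := hη.trans_le h1
    rw [edist_dist, ENNReal.ofReal_lt_ofReal_iff_of_nonneg (by linarith)] at h2
    have := (hP.radius_le p hp).trans (min_le_right _ _)
    have := (hQ.radius_le q hq).trans (min_le_right _ _)
    linarith
  have hball : ∀ p ∈ P, ∀ q ∈ Q,
      Disjoint (Metric.closedBall p.1 p.2) (Metric.closedBall q.1 q.2) := fun p hp q hq =>
    Metric.closedBall_disjoint_closedBall (hlt p hp q hq)
  have hdisj : Disjoint P Q := Set.disjoint_left.2 fun p hp hq => by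
    have := hlt p hp p hq
    have := hP.radius_pos p hp
    rw [dist_self] at *
    linarith
  have hPQ : IsPacking (min δ η) (s ∪ t) (P ∪ Q) := by
    refine ⟨?_, ?_, ?_, ?_⟩
    · rintro p (hp | hp)
      · exact Or.inl (hP.center_mem p hp)
      · exact Or.inr (hQ.center_mem p hp)
    · rintro p (hp | hp)
      · exact hP.radius_pos p hp
      · exact hQ.radius_pos p hp
    · rintro p (hp | hp)
      · exact hP.radius_le p hp
      · exact hQ.radius_le p hp
    · exact Set.pairwiseDisjoint_union.2
        ⟨hP.disjoint, hQ.disjoint, fun p hp q hq _ => hball p hp q hq⟩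
  refine le_trans (le_of_eq ?_) (le_iSup₂_of_le (P ∪ Q) hPQ le_rfl)
  exact (Summable.tsum_union_disjoint (f := fun p : X × ℝ => ENNReal.ofReal (Ψ (2 * p.2)))
    hdisj ENNReal.summable ENNReal.summable).symm

/-- The packing outer measure: the infimum of `∑ 𝒫^Ψ (E_i)` over countable coverings
`E ⊆ ⋃ E_i` by arbitrary sets. -/
def packingOuterMeasure {X : Type*} [MetricSpace X] (Ψ : ℝ → ℝ) : OuterMeasure X :=
  OuterMeasure.ofFunction (packingPremeasure Ψ) (packingPremeasure_empty Ψ)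

theorem packingOuterMeasure_isMetric {X : Type*} [MetricSpace X] (Ψ : ℝ → ℝ) :
    (packingOuterMeasure Ψ : OuterMeasure X).IsMetric := by
  intro s t hst
  refine le_antisymm (measure_union_le s t) ?_
  conv_rhs => rw [packingOuterMeasure, OuterMeasure.ofFunction_apply]
  refine le_iInf₂ fun f hf => ?_
  have hs : packingOuterMeasure Ψ s ≤ ∑' n, packingPremeasure Ψ (f n ∩ s) := by
    rw [packingOuterMeasure, OuterMeasure.ofFunction_apply]
    refine iInf₂_le _ ?_
    rw [← Set.iUnion_inter]
    exact Set.subset_inter (Set.subset_union_left.trans hf) le_rfl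
  have ht : packingOuterMeasure Ψ t ≤ ∑' n, packingPremeasure Ψ (f n ∩ t) := by
    rw [packingOuterMeasure, OuterMeasure.ofFunction_apply]
    refine iInf₂_le _ ?_
    rw [← Set.iUnion_inter]
    exact Set.subset_inter (Set.subset_union_right.trans hf) le_rfl
  refine (add_le_add hs ht).trans ?_
  rw [← ENNReal.tsum_add]
  refine ENNReal.tsum_le_tsum fun n => ?_
  refine (packingPremeasure_add_le Ψ
    (hst.mono Set.inter_subset_right Set.inter_subset_right)).trans ?_
  exact packingPremeasure_mono Ψ (Set.union_subset Set.inter_subset_left Set.inter_subset_left)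

/-- The packing measure with gauge `Ψ`, as a Borel measure. -/
def packingGaugeMeasure {X : Type*} [MetricSpace X] [MeasurableSpace X] [BorelSpace X]
    (Ψ : ℝ → ℝ) : Measure X :=
  (packingOuterMeasure Ψ).toMeasure
    (BorelSpace.measurable_eq (α := X) ▸ (packingOuterMeasure_isMetric Ψ).borel_le_caratheodory)

/-! ### `ℓ`-adic cubes and quasi-Bernoulli measures -/

/-- The `ℓ`-adic cube `∏ i, [k i / ℓ ^ n, (k i + 1) / ℓ ^ n)` of generation `n` in `[0,1)^D`. -/
def adicCube (D ℓ n : ℕ) (k : Fin D → Fin (ℓ ^ n)) : Set (EuclideanSpace ℝ (Fin D)) :=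
  {x | ∀ i, ((k i : ℕ) : ℝ) / (ℓ : ℝ) ^ n ≤ x i ∧ x i < (((k i : ℕ) : ℝ) + 1) / (ℓ : ℝ) ^ n}

/-- A coding of the `ℓ`-adic cubes by words over an alphabet with `ℓ ^ D` letters: for every
`n`, a bijection between the words of length `n` and the cubes of generation `n`, such that
deleting the last letter of a word gives a larger cube. -/
structure CubeCoding (D ℓ : ℕ) where
  code : ∀ n : ℕ, (Fin n → Fin (ℓ ^ D)) ≃ (Fin D → Fin (ℓ ^ n))
  nested : ∀ (n : ℕ) (w : Fin (n + 1) → Fin (ℓ ^ D)),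
    adicCube D ℓ (n + 1) (code (n + 1) w) ⊆ adicCube D ℓ n (code n (Fin.init w))

/-- The cube `I_w` coded by the word `w`. -/
def CubeCoding.cube {D ℓ : ℕ} (c : CubeCoding D ℓ) {n : ℕ} (w : Fin n → Fin (ℓ ^ D)) :
    Set (EuclideanSpace ℝ (Fin D)) :=
  adicCube D ℓ n (c.code n w)

/-- `m` is a quasi-Bernoulli probability measure on `[0,1)^D` with respect to the coding `c`.
If `I = I_w` and `J = I_v`, then `IJ` is the cube coded by the concatenation of `w` and `v`. -/
structure IsQuasiBernoulli {D ℓ : ℕ} (c : CubeCoding D ℓ)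
    (m : Measure (EuclideanSpace ℝ (Fin D))) : Prop where
  isProbabilityMeasure : IsProbabilityMeasure m
  unitCube : m {x | ∀ i, 0 ≤ x i ∧ x i < 1} = 1
  quasiMul : ∃ C : ℝ, 1 ≤ C ∧
    ∀ (n p : ℕ) (w : Fin n → Fin (ℓ ^ D)) (v : Fin p → Fin (ℓ ^ D)),
      1 / C * (m.real (c.cube w) * m.real (c.cube v)) ≤ m.real (c.cube (Fin.append w v)) ∧
      m.real (c.cube (Fin.append w v)) ≤ C * (m.real (c.cube w) * m.real (c.cube v))

open Classical in
/-- `τ_n(q) = (1 / (n log ℓ)) log (∑ m(I)^q)`, the sum running over the cubes `I` of generation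
`n` with `m(I) ≠ 0` (that is, with the convention `0 ^ q = 0` for all `q`). -/
def lqSpectrumAux (D ℓ : ℕ) (m : Measure (EuclideanSpace ℝ (Fin D))) (n : ℕ) (q : ℝ) : ℝ :=
  1 / ((n : ℝ) * Real.log ℓ) *
    Real.log (∑ k : Fin D → Fin (ℓ ^ n) with m.real (adicCube D ℓ n k) ≠ 0,
      m.real (adicCube D ℓ n k) ^ q)

/-- The `L^q`-spectrum `τ(q) = limsup τ_n(q)`. -/
def lqSpectrum (D ℓ : ℕ) (m : Measure (EuclideanSpace ℝ (Fin D))) (q : ℝ) : ℝ :=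
  limsup (fun n : ℕ => lqSpectrumAux D ℓ m n q) atTop

/-- `Θ(t) = ℓ ^ √(2 log_ℓ (1/t) log_ℓ log_ℓ log_ℓ (1/t))`; only small `t > 0` matter. -/
def lilTheta (ℓ : ℕ) (t : ℝ) : ℝ :=
  (ℓ : ℝ) ^ Real.sqrt (2 * Real.logb ℓ (1 / t) *
    Real.logb ℓ (Real.logb ℓ (Real.logb ℓ (1 / t))))

end

/-! ### The law of the iterated logarithm rate -/

/-! The heart is the upper half of a law of the iterated logarithm: for every `s > σ` and `m`-almost
every `x`, the cube `I` of generation `n` containing `x` eventually satisfies `|log_ℓ m(I) + n d| ≤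
s √(2 n log_ℓ log_ℓ n)`.

Its source is a quasi-martingale. By the quasi-Bernoulli property, the logarithm of `∑ m(I)^q` over
generation `n` is additive in `n` up to a bounded error, so for `q > 0` it equals `n τ(q) log ℓ` up
to a constant (`abs_log_treeSum_sub_le`). Hence for `q < 1` the weights `m(I)^(1-q) ℓ^(-n τ(1-q))`
have, over the descendants of any cube, sums comparable to the weight of that cube. Stopping at the
first cube where weight over mass reaches `R` gives a maximal inequality with bound `K / R`, uniform
for `-1 ≤ q < 1` (`exists_maximal_le`).

The expansion of `τ` at `1` says that the logarithm of the mass has variance at most about `σ²` per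
generation. With `q` of order `±√(log log N / N)` the maximal inequality becomes a Chernoff bound,
summable over geometric blocks of generations, and Borel–Cantelli applies (`ae_lil_one_sided`).

The rest is geometric. The points obeying the law from generation `n₀` on form the sets `lilSet`,
whose union carries `m`. A set of diameter at most `t` meets at most `3^D` cubes of side comparable
to `t`, and those meeting `lilSet` have small mass: the mass distribution principle gives the first
claim. A ball of radius `r` centred in `lilSet` contains a cube of side comparable to `r` and large
mass; disjointness of the balls of a packing gives the second claim. -/

/-- The rate `√(2 x log_b log_b x)` of the law of the iterated logarithm, in base `b`. -/
noncomputable def lilRate (b x : ℝ) : ℝ :=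
  Real.sqrt (2 * x * Real.logb b (Real.logb b x))

theorem lilRate_nonneg (b x : ℝ) : 0 ≤ lilRate b x := Real.sqrt_nonneg _

theorem tendsto_logb_logb_atTop {b : ℝ} (hb : 1 < b) :
    Tendsto (fun x => Real.logb b (Real.logb b x)) atTop atTop :=
  (Real.tendsto_logb_atTop hb).comp (Real.tendsto_logb_atTop hb)

theorem tendsto_lilRate_atTop {b : ℝ} (hb : 1 < b) : Tendsto (lilRate b) atTop atTop :=
  Real.tendsto_sqrt_atTop.comp <|
    (tendsto_id.const_mul_atTop (two_pos)).atTop_mul_atTop₀ (tendsto_logb_logb_atTop hb)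

theorem lilRate_sq {b x : ℝ} (hx : 0 ≤ x) (hL : 0 ≤ Real.logb b (Real.logb b x)) :
    lilRate b x ^ 2 = 2 * x * Real.logb b (Real.logb b x) :=
  Real.sq_sqrt (by positivity)

theorem lilRate_mono {b x y : ℝ} (hb : 1 < b) (hx : b ≤ x) (hxy : x ≤ y) :
    lilRate b x ≤ lilRate b y := by
  have hb0 : 0 < b := by linarith
  have h1 : 1 ≤ Real.logb b x := by
    rw [Real.le_logb_iff_rpow_le hb (by linarith)]; simpa using hx
  have h2 : Real.logb b x ≤ Real.logb b y := Real.logb_le_logb_of_le hb (by linarith) hxy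
  have h3 : 0 ≤ Real.logb b (Real.logb b x) := Real.logb_nonneg hb h1
  have h4 := Real.logb_le_logb_of_le hb (by linarith) h2
  refine Real.sqrt_le_sqrt ?_
  have : 0 ≤ 2 * y := by linarith
  gcongr

/-- Enlarging the argument by a factor at most `ρ` enlarges both `x` and, for large `x`, `log log x`
by at most `ρ`, hence the rate by at most `ρ`. Any gap between two constants therefore absorbs a
move inside a geometric block, or from a real scale to a nearby generation. -/
theorem exists_lilRate_mul_le {b s₁ s₂ : ℝ} (hb : 1 < b) (h₁ : 0 ≤ s₁) (h₁₂ : s₁ < s₂) :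
    ∃ ρ > 1, ∃ X, ∀ x ≥ X, ∀ y, x ≤ y → y ≤ ρ * x →
      s₁ * lilRate b y ≤ s₂ * lilRate b x := by
  obtain ⟨ρ, hρ1, hρ⟩ : ∃ ρ > 1, s₁ * ρ ≤ s₂ := by
    rcases h₁.eq_or_lt with h | h
    · exact ⟨2, by norm_num, by rw [← h]; linarith⟩
    · exact ⟨s₂ / s₁, by rwa [gt_iff_lt, one_lt_div h], by rw [mul_div_cancel₀ _ h.ne']⟩
  have hev : ∀ᶠ x in atTop, b ≤ x ∧ Real.logb b ρ ≤ Real.logb b x ∧ 1 ≤ Real.logb b x ∧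
      Real.logb b 2 / (ρ - 1) ≤ Real.logb b (Real.logb b x) := by
    filter_upwards [eventually_ge_atTop b, (Real.tendsto_logb_atTop hb).eventually_ge_atTop _,
      (Real.tendsto_logb_atTop hb).eventually_ge_atTop 1,
      (tendsto_logb_logb_atTop hb).eventually_ge_atTop _] with x h1 h2 h3 h4
    exact ⟨h1, h2, h3, h4⟩
  obtain ⟨X, hX⟩ := eventually_atTop.1 hev
  refine ⟨ρ, hρ1, X, fun x hx y hxy hy => ?_⟩
  obtain ⟨h1, h2, h3, h4⟩ := hX x hx
  have hx0 : 0 < x := by linarith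
  have hL : 0 ≤ Real.logb b (Real.logb b x) := Real.logb_nonneg hb h3
  rw [div_le_iff₀ (by linarith)] at h4
  have hLy : Real.logb b (Real.logb b y) ≤ ρ * Real.logb b (Real.logb b x) := by
    have hy1 : Real.logb b y ≤ 2 * Real.logb b x :=
      calc Real.logb b y ≤ Real.logb b (ρ * x) := Real.logb_le_logb_of_le hb (by linarith) hy
        _ = Real.logb b ρ + Real.logb b x := Real.logb_mul (by linarith) hx0.ne'
        _ ≤ _ := by linarith
    have hy0 : Real.logb b x ≤ Real.logb b y := Real.logb_le_logb_of_le hb hx0 hxy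
    calc Real.logb b (Real.logb b y) ≤ Real.logb b (2 * Real.logb b x) :=
          Real.logb_le_logb_of_le hb (by linarith) hy1
      _ = Real.logb b 2 + Real.logb b (Real.logb b x) :=
          Real.logb_mul (by norm_num) (by linarith)
      _ ≤ _ := by linarith
  have hyx : lilRate b y ≤ ρ * lilRate b x := by
    rw [lilRate]
    refine Real.sqrt_le_iff.2 ⟨mul_nonneg (by linarith) (lilRate_nonneg _ _), ?_⟩
    rw [mul_pow, lilRate_sq hx0.le hL]
    calc 2 * y * Real.logb b (Real.logb b y)
        ≤ 2 * (ρ * x) * (ρ * Real.logb b (Real.logb b x)) := by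
          have : 0 ≤ ρ * Real.logb b (Real.logb b x) := mul_nonneg (by linarith) hL
          have : 0 ≤ 2 * (ρ * x) := by linarith
          calc _ ≤ 2 * y * (ρ * Real.logb b (Real.logb b x)) :=
                mul_le_mul_of_nonneg_left hLy (by linarith)
            _ ≤ _ := by gcongr
      _ = _ := by ring
  calc s₁ * lilRate b y ≤ s₁ * (ρ * lilRate b x) := by gcongr
    _ = s₁ * ρ * lilRate b x := by ring
    _ ≤ _ := mul_le_mul_of_nonneg_right hρ (lilRate_nonneg _ _)

theorem tendsto_logb_div_self (b : ℝ) :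
    Tendsto (fun x => Real.logb b x / x) atTop (𝓝 0) := by
  have h := Real.isLittleO_log_id_atTop.tendsto_div_nhds_zero.div_const (Real.log b)
  rw [zero_div] at h
  refine h.congr fun x => ?_
  simp only [Real.logb, id]
  ring

/-- This makes the Chernoff parameter, proportional to rate over length, tend to `0`, where the
expansion of `τ` applies. -/
theorem tendsto_lilRate_div_self {b : ℝ} (hb : 1 < b) :
    Tendsto (fun x => lilRate b x / x) atTop (𝓝 0) := by
  have h := (((tendsto_logb_div_self b).comp (Real.tendsto_logb_atTop hb)).mul
    (tendsto_logb_div_self b)).const_mul 2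
  have h' := (Real.continuous_sqrt.tendsto _).comp h
  simp only [mul_zero, Real.sqrt_zero] at h'
  refine h'.congr' ?_
  filter_upwards [eventually_ge_atTop 1, (Real.tendsto_logb_atTop hb).eventually_ge_atTop 1]
    with x hx hL
  have hx0 : 0 < x := by linarith
  have hL0 : Real.logb b x ≠ 0 := by linarith
  rw [lilRate, eq_div_iff hx0.ne', Function.comp_apply]
  conv_lhs => rw [← Real.sqrt_sq hx0.le, mul_comm, ← Real.sqrt_mul (sq_nonneg x)]
  congr 1
  simp only [Function.comp_apply]
  rw [Real.sqrt_sq hx0.le]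
  field_simp

/-! ### Sums over the descendants of a word -/

section TreeSum

variable {A : Type*} [Fintype A]

/-- The sum of `φ` over all words that extend `w` by `p` letters. -/
def treeSum (φ : List A → ℝ) : ℕ → List A → ℝ
  | 0, w => φ w
  | p + 1, w => ∑ a, treeSum φ p (w ++ [a])

theorem treeSum_eq_sum (φ : List A → ℝ) (p : ℕ) (w : List A) :
    treeSum φ p w = ∑ v : Fin p → A, φ (w ++ List.ofFn v) := by
  induction p generalizing w with
  | zero => simp [treeSum]
  | succ p ih =>
    rw [treeSum, ← (Fin.consEquiv fun _ => A).sum_comp, Fintype.sum_prod_type]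
    refine Finset.sum_congr rfl fun a _ => ?_
    rw [ih]
    refine Finset.sum_congr rfl fun v _ => ?_
    simp [Fin.consEquiv, List.ofFn_succ]

theorem le_treeSum_append {φ : List A → ℝ} {K : ℝ}
    (h : ∀ w v, K * (φ w * φ v) ≤ φ (w ++ v)) (p : ℕ) (w v : List A) :
    K * (φ w * treeSum φ p v) ≤ treeSum φ p (w ++ v) := by
  induction p generalizing v with
  | zero => exact h w v
  | succ p ih =>
    simp only [treeSum, Finset.mul_sum]
    refine Finset.sum_le_sum fun a _ => ?_
    simpa using ih (v ++ [a])

theorem treeSum_append_le {φ : List A → ℝ} {K : ℝ}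
    (h : ∀ w v, φ (w ++ v) ≤ K * (φ w * φ v)) (p : ℕ) (w v : List A) :
    treeSum φ p (w ++ v) ≤ K * (φ w * treeSum φ p v) := by
  induction p generalizing v with
  | zero => exact h w v
  | succ p ih =>
    simp only [treeSum, Finset.mul_sum]
    refine Finset.sum_le_sum fun a _ => ?_
    simpa using ih (v ++ [a])

theorem le_treeSum_add {φ : List A → ℝ} {K : ℝ}
    (h : ∀ w v, K * (φ w * φ v) ≤ φ (w ++ v)) (n p : ℕ) (w : List A) :
    K * (treeSum φ n w * treeSum φ p []) ≤ treeSum φ (n + p) w := by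
  induction n generalizing w with
  | zero => simpa [treeSum] using le_treeSum_append h p w []
  | succ n ih =>
    rw [Nat.add_right_comm]
    simp only [treeSum, Finset.mul_sum, Finset.sum_mul]
    exact Finset.sum_le_sum fun a _ => ih _

theorem treeSum_add_le {φ : List A → ℝ} {K : ℝ}
    (h : ∀ w v, φ (w ++ v) ≤ K * (φ w * φ v)) (n p : ℕ) (w : List A) :
    treeSum φ (n + p) w ≤ K * (treeSum φ n w * treeSum φ p []) := by
  induction n generalizing w with
  | zero => simpa [treeSum] using treeSum_append_le h p w []
  | succ n ih =>
    rw [Nat.add_right_comm]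
    simp only [treeSum, Finset.mul_sum, Finset.sum_mul]
    exact Finset.sum_le_sum fun a _ => ih _

/-- A maximal inequality on a tree of nested sets: if each bad word `w ∈ G` satisfies
`μ (I w) ≤ κ ∑ φ`, the sum being over its descendants at any depth, then so does the union of
the sets of all bad words of bounded length. -/
theorem measureReal_iUnion_le_treeSum {X : Type*} [MeasurableSpace X] (μ : Measure X)
    [IsFiniteMeasure μ] {I : List A → Set X} (hI : ∀ w v, I (w ++ v) ⊆ I w)
    {φ : List A → ℝ} (hφ : ∀ w, 0 ≤ φ w) {κ : ℝ} (hκ : 0 ≤ κ) {G : Set (List A)}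
    (hG : ∀ w ∈ G, ∀ p, μ.real (I w) ≤ κ * treeSum φ p w) (p : ℕ) (w : List A) :
    μ.real {x | ∃ v : List A, v.length ≤ p ∧ w ++ v ∈ G ∧ x ∈ I (w ++ v)} ≤
      κ * treeSum φ p w := by
  -- This is stopping at the first bad word: a bad `w` has a set containing those of all its
  -- descendants, and its hypothesis at depth `p` finishes; otherwise the children are treated by
  -- induction.
  by_cases hw : w ∈ G
  · refine (measureReal_mono ?_).trans (hG w hw p)
    rintro x ⟨v, -, -, hx⟩
    exact hI w v hx
  induction p generalizing w with
  | zero =>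
    have : {x | ∃ v : List A, v.length ≤ 0 ∧ w ++ v ∈ G ∧ x ∈ I (w ++ v)} = ∅ := by
      ext x; simp [hw]
    rw [this, measureReal_empty]
    exact mul_nonneg hκ (hφ w)
  | succ p ih =>
    rw [treeSum, Finset.mul_sum]
    have hsub : {x | ∃ v : List A, v.length ≤ p + 1 ∧ w ++ v ∈ G ∧ x ∈ I (w ++ v)} ⊆
        ⋃ a : A, {x | ∃ v : List A, v.length ≤ p ∧ (w ++ [a]) ++ v ∈ G ∧
          x ∈ I ((w ++ [a]) ++ v)} := by
      rintro x ⟨v, hv, hvG, hx⟩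
      cases v with
      | nil => exact absurd (by simpa using hvG) hw
      | cons a v => exact Set.mem_iUnion.2 ⟨a, v, by simpa using hv, by simpa using hvG,
          by simpa using hx⟩
    refine (measureReal_mono hsub).trans ((measureReal_iUnion_fintype_le _).trans ?_)
    refine Finset.sum_le_sum fun a _ => ?_
    by_cases ha : w ++ [a] ∈ G
    · refine (measureReal_mono ?_).trans (hG _ ha p)
      rintro x ⟨v, -, -, hx⟩
      exact hI _ v hx
    · exact ih _ ha

end TreeSum

/-! ### Almost additive sequences -/

/-- Since `f + k` is subadditive, Fekete's lemma identifies the limit with the infimum of `(f n + k)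
/ n`, which also gives the one-sided bound. Applied to `f` and `-f`, this yields the two-sided
bound. -/
theorem exists_tendsto_div_and_mul_le {f : ℕ → ℝ} {k : ℝ}
    (h : ∀ n p, |f (n + p) - f n - f p| ≤ k) :
    ∃ L, Tendsto (fun n : ℕ => f n / n) atTop (𝓝 L) ∧ ∀ n : ℕ, n * L ≤ f n + k := by
  have hk : 0 ≤ k := (abs_nonneg _).trans (h 0 0)
  have hsub : Subadditive fun n => f n + k := fun n p => by
    have := (abs_le.1 (h n p)).2
    linarith
  have hlow : ∀ n : ℕ, n * (f 1 - k) ≤ f n + k := by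
    intro n
    induction n with
    | zero =>
      have := (abs_le.1 (h 0 0)).2
      norm_num at this ⊢
      linarith
    | succ n ih =>
      have := (abs_le.1 (h n 1)).1
      push_cast
      linarith
  have hbdd : BddBelow (Set.range fun n : ℕ => (f n + k) / n) := by
    refine ⟨-|f 1 - k|, ?_⟩
    rintro _ ⟨n, rfl⟩
    rcases n.eq_zero_or_pos with rfl | hn
    · simp
    · have hn' : (0 : ℝ) < n := by exact_mod_cast hn
      rw [le_div_iff₀ hn']
      have := hlow n
      nlinarith [neg_abs_le (f 1 - k)]
  refine ⟨hsub.lim, ?_, fun n => ?_⟩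
  · have h1 := (hsub.tendsto_lim hbdd).sub (tendsto_const_div_atTop_nhds_zero_nat k)
    rw [sub_zero] at h1
    exact h1.congr fun n => by ring
  · rcases n.eq_zero_or_pos with rfl | hn
    · simpa using hlow 0
    · have hn' : (0 : ℝ) < n := by exact_mod_cast hn
      have := hsub.lim_le_div hbdd hn.ne'
      rw [le_div_iff₀ hn'] at this
      linarith

theorem exists_tendsto_div_and_abs_sub_le {f : ℕ → ℝ} {k : ℝ}
    (h : ∀ n p, |f (n + p) - f n - f p| ≤ k) :
    ∃ L, Tendsto (fun n : ℕ => f n / n) atTop (𝓝 L) ∧ ∀ n : ℕ, |f n - n * L| ≤ k := by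
  obtain ⟨L, hL, h1⟩ := exists_tendsto_div_and_mul_le h
  obtain ⟨L', hL', h2⟩ := exists_tendsto_div_and_mul_le (f := fun n => -f n) (k := k)
    fun n p => by rw [← abs_neg]; convert h n p using 2; ring
  have : L' = -L := tendsto_nhds_unique hL' (hL.neg.congr fun n => by ring)
  subst this
  refine ⟨L, hL, fun n => abs_le.2 ⟨?_, ?_⟩⟩
  · linarith [h1 n]
  · linarith [h2 n]

/-! ### Cubes and their masses -/

section Cubes

theorem measurableSet_adicCube (D ℓ n : ℕ) (k : Fin D → Fin (ℓ ^ n)) :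
    MeasurableSet (adicCube D ℓ n k) := by
  have : adicCube D ℓ n k = ⋂ i, (fun x : EuclideanSpace ℝ (Fin D) => x i) ⁻¹'
      Set.Ico (((k i : ℕ) : ℝ) / (ℓ : ℝ) ^ n) ((((k i : ℕ) : ℝ) + 1) / (ℓ : ℝ) ^ n) := by
    ext x; simp [adicCube]
  rw [this]
  exact MeasurableSet.iInter fun i => measurableSet_Ico.preimage (by fun_prop)

theorem exists_mem_adicCube {D ℓ : ℕ} (hℓ : 0 < ℓ) (n : ℕ) {x : EuclideanSpace ℝ (Fin D)}
    (hx : ∀ i, 0 ≤ x i ∧ x i < 1) : ∃ k, x ∈ adicCube D ℓ n k := by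
  have hpow : (0 : ℝ) < (ℓ : ℝ) ^ n := by positivity
  have hlt : ∀ i, ⌊x i * (ℓ : ℝ) ^ n⌋₊ < ℓ ^ n := fun i => by
    rw [Nat.floor_lt (mul_nonneg (hx i).1 hpow.le)]
    push_cast
    exact mul_lt_of_lt_one_left hpow (hx i).2
  refine ⟨fun i => ⟨⌊x i * (ℓ : ℝ) ^ n⌋₊, hlt i⟩, fun i => ⟨?_, ?_⟩⟩
  · rw [div_le_iff₀ hpow]
    exact Nat.floor_le (mul_nonneg (hx i).1 hpow.le)
  · rw [lt_div_iff₀ hpow]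
    exact Nat.lt_floor_add_one _

variable {D ℓ : ℕ}

/-- The cube coded by a word, the word being given as a list. -/
def CubeCoding.listCube (c : CubeCoding D ℓ) (w : List (Fin (ℓ ^ D))) :
    Set (EuclideanSpace ℝ (Fin D)) :=
  c.cube w.get

/-- The length of `List.ofFn w` is only propositionally `n`; equality of the pairs (length, word)
avoids a transport. -/
theorem CubeCoding.listCube_ofFn (c : CubeCoding D ℓ) {n : ℕ} (w : Fin n → Fin (ℓ ^ D)) :
    c.listCube (List.ofFn w) = c.cube w := by
  have h : (⟨_, (List.ofFn w).get⟩ : Σ n, Fin n → Fin (ℓ ^ D)) = ⟨n, w⟩ :=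
    List.ofFn_inj'.1 (List.ofFn_get _)
  exact congrArg (fun s : Σ n, Fin n → Fin (ℓ ^ D) => c.cube s.2) h

theorem CubeCoding.listCube_append_subset (c : CubeCoding D ℓ) (w v : List (Fin (ℓ ^ D))) :
    c.listCube (w ++ v) ⊆ c.listCube w := by
  induction v using List.reverseRecOn with
  | nil => simp
  | append_singleton v a ih =>
    refine Set.Subset.trans ?_ ih
    rw [← List.append_assoc]
    generalize w ++ v = u
    have h := c.nested u.length (Fin.snoc (α := fun _ => Fin (ℓ ^ D)) u.get a)
    rw [Fin.init_snoc] at h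
    refine Set.Subset.trans (le_of_eq ?_) h
    change _ = c.cube (Fin.snoc (α := fun _ => Fin (ℓ ^ D)) u.get a)
    rw [← c.listCube_ofFn]
    congr 1
    simp only [List.ofFn_succ', Fin.snoc_castSucc, Fin.snoc_last, List.ofFn_get,
      List.concat_eq_append]

theorem CubeCoding.exists_listCube_eq (c : CubeCoding D ℓ) {n : ℕ} (k : Fin D → Fin (ℓ ^ n)) :
    ∃ w : List (Fin (ℓ ^ D)), w.length = n ∧ c.listCube w = adicCube D ℓ n k :=
  ⟨List.ofFn ((c.code n).symm k), by simp, by rw [c.listCube_ofFn]; simp [CubeCoding.cube]⟩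

theorem sum_adicCube_eq_treeSum (c : CubeCoding D ℓ) (m : Measure (EuclideanSpace ℝ (Fin D)))
    (n : ℕ) (f : ℝ → ℝ) :
    ∑ k : Fin D → Fin (ℓ ^ n), f (m.real (adicCube D ℓ n k)) =
      treeSum (fun w => f (m.real (c.listCube w))) n [] := by
  rw [treeSum_eq_sum, ← (c.code n).sum_comp]
  simp [c.listCube_ofFn, CubeCoding.cube]

/-- For `q ≠ 0` the cubes of mass zero contribute `0 ^ q = 0`, so leaving them out changes nothing.
-/
theorem lqSpectrumAux_eq (c : CubeCoding D ℓ) (m : Measure (EuclideanSpace ℝ (Fin D)))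
    (n : ℕ) {q : ℝ} (hq : q ≠ 0) :
    lqSpectrumAux D ℓ m n q = Real.log (treeSum (fun w => m.real (c.listCube w) ^ q) n []) / n /
      Real.log ℓ := by
  classical
  rw [lqSpectrumAux, ← sum_adicCube_eq_treeSum c m n (· ^ q), Finset.sum_filter_of_ne]
  · ring
  · intro k _ h h0
    rw [h0, Real.zero_rpow hq] at h
    exact h rfl

theorem treeSum_mul_pow_length {A : Type*} [Fintype A] (f : List A → ℝ) (r : ℝ) (p : ℕ)
    (w : List A) :
    treeSum (fun w => f w * r ^ w.length) p w = treeSum f p w * r ^ (w.length + p) := by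
  induction p generalizing w with
  | zero => rfl
  | succ p ih =>
    simp only [treeSum, ih, Finset.sum_mul, List.length_append, List.length_singleton]
    refine Finset.sum_congr rfl fun a _ => ?_
    congr 2
    ring

namespace IsQuasiBernoulli

variable {c : CubeCoding D ℓ} {m : Measure (EuclideanSpace ℝ (Fin D))}

theorem exists_listCube (hm : IsQuasiBernoulli c m) :
    ∃ C : ℝ, 1 ≤ C ∧ ∀ w v,
      C⁻¹ * (m.real (c.listCube w) * m.real (c.listCube v)) ≤ m.real (c.listCube (w ++ v)) ∧
      m.real (c.listCube (w ++ v)) ≤ C * (m.real (c.listCube w) * m.real (c.listCube v)) := by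
  obtain ⟨C, hC, h⟩ := hm.quasiMul
  refine ⟨C, hC, fun w v => ?_⟩
  have := h _ _ w.get v.get
  rw [← c.listCube_ofFn (Fin.append _ _), List.ofFn_fin_append, List.ofFn_get, List.ofFn_get,
    one_div] at this
  exact this

theorem treeSum_rpow_pos (hm : IsQuasiBernoulli c m) (hℓ : 0 < ℓ) (n : ℕ) (q : ℝ) :
    0 < treeSum (fun w => m.real (c.listCube w) ^ q) n [] := by
  have := hm.isProbabilityMeasure
  rw [← sum_adicCube_eq_treeSum c m n (· ^ q)]
  have hsum : 0 < ∑ k : Fin D → Fin (ℓ ^ n), m.real (adicCube D ℓ n k) := by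
    have h1 : m.real {x | ∀ i, 0 ≤ x i ∧ x i < 1} = 1 := by simp [measureReal_def, hm.unitCube]
    have h2 : {x : EuclideanSpace ℝ (Fin D) | ∀ i, 0 ≤ x i ∧ x i < 1} ⊆
        ⋃ k, adicCube D ℓ n k := fun x hx => Set.mem_iUnion.2 (exists_mem_adicCube hℓ n hx)
    exact (h1 ▸ one_pos).trans_le ((measureReal_mono h2).trans (measureReal_iUnion_fintype_le _))
  obtain ⟨k, -, hk⟩ := Finset.exists_ne_zero_of_sum_ne_zero hsum.ne'
  have hk' : 0 < m.real (adicCube D ℓ n k) := lt_of_le_of_ne measureReal_nonneg hk.symm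
  exact Finset.sum_pos' (fun _ _ => Real.rpow_nonneg measureReal_nonneg _)
    ⟨k, Finset.mem_univ _, Real.rpow_pos_of_pos hk' _⟩

theorem rpow_listCube {C : ℝ} (hC : 1 ≤ C)
    (h : ∀ w v,
      C⁻¹ * (m.real (c.listCube w) * m.real (c.listCube v)) ≤ m.real (c.listCube (w ++ v)) ∧
      m.real (c.listCube (w ++ v)) ≤ C * (m.real (c.listCube w) * m.real (c.listCube v)))
    {q : ℝ} (hq : 0 ≤ q) (w v) :
      (C ^ q)⁻¹ * (m.real (c.listCube w) ^ q * m.real (c.listCube v) ^ q) ≤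
        m.real (c.listCube (w ++ v)) ^ q ∧
      m.real (c.listCube (w ++ v)) ^ q ≤
        C ^ q * (m.real (c.listCube w) ^ q * m.real (c.listCube v) ^ q) := by
  have hC0 : 0 ≤ C := by linarith
  have hw : 0 ≤ m.real (c.listCube w) := measureReal_nonneg
  have hv : 0 ≤ m.real (c.listCube v) := measureReal_nonneg
  rw [← Real.inv_rpow hC0, ← Real.mul_rpow hw hv, ← Real.mul_rpow (by positivity) (by positivity),
    ← Real.mul_rpow hC0 (by positivity)]
  exact ⟨Real.rpow_le_rpow (by positivity) (h w v).1 hq,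
    Real.rpow_le_rpow measureReal_nonneg (h w v).2 hq⟩

/-- Raising the quasi-Bernoulli inequalities to the power `q` makes the log-sums almost additive
with error `log (C ^ q)`. The limsup defining `τ(q)` is thus a limit, approached with bounded total
error. -/
theorem abs_log_treeSum_sub_le (hm : IsQuasiBernoulli c m) (hℓ : 2 ≤ ℓ) {C : ℝ} (hC : 1 ≤ C)
    (h : ∀ w v,
      C⁻¹ * (m.real (c.listCube w) * m.real (c.listCube v)) ≤ m.real (c.listCube (w ++ v)) ∧
      m.real (c.listCube (w ++ v)) ≤ C * (m.real (c.listCube w) * m.real (c.listCube v)))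
    {q : ℝ} (hq : 0 < q) (n : ℕ) :
    |Real.log (treeSum (fun w => m.real (c.listCube w) ^ q) n []) -
      n * (lqSpectrum D ℓ m q * Real.log ℓ)| ≤ Real.log (C ^ q) := by
  set Z : ℕ → ℝ := fun n => treeSum (fun w => m.real (c.listCube w) ^ q) n [] with hZ
  have hpos : ∀ n, 0 < Z n := fun n => hm.treeSum_rpow_pos (by omega) n q
  have hCq : 0 < C ^ q := Real.rpow_pos_of_pos (by linarith) _
  have hlogℓ : 0 < Real.log ℓ := Real.log_pos (by exact_mod_cast hℓ)
  have key : ∀ n p, |Real.log (Z (n + p)) - Real.log (Z n) - Real.log (Z p)| ≤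
      Real.log (C ^ q) := by
    intro n p
    have h1 := le_treeSum_add (φ := fun w => m.real (c.listCube w) ^ q)
      (fun w v => (rpow_listCube hC h hq.le w v).1) n p []
    have h2 := treeSum_add_le (φ := fun w => m.real (c.listCube w) ^ q)
      (fun w v => (rpow_listCube hC h hq.le w v).2) n p []
    have hnp := mul_pos (hpos n) (hpos p)
    have h1' := Real.log_le_log (mul_pos (inv_pos.2 hCq) hnp) h1
    have h2' := Real.log_le_log (hpos (n + p)) h2
    rw [Real.log_mul (inv_pos.2 hCq).ne' hnp.ne', Real.log_inv,
      Real.log_mul (hpos n).ne' (hpos p).ne'] at h1'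
    rw [Real.log_mul hCq.ne' hnp.ne', Real.log_mul (hpos n).ne' (hpos p).ne'] at h2'
    rw [abs_le]
    constructor <;> simp only [hZ] <;> linarith
  obtain ⟨L, hL, hbound⟩ := exists_tendsto_div_and_abs_sub_le (f := fun n => Real.log (Z n)) key
  have hτ : lqSpectrum D ℓ m q = L / Real.log ℓ := by
    refine Tendsto.limsup_eq ((hL.div_const (Real.log ℓ)).congr fun n => ?_)
    rw [lqSpectrumAux_eq c m n hq.ne']
  rw [hτ, div_mul_cancel₀ _ hlogℓ.ne']
  exact hbound n

/-- The maximal inequality for the quasi-martingale `m(I)^{-q} ℓ^{-n τ(1-q)}`. -/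
theorem exists_maximal_le (hm : IsQuasiBernoulli c m) (hℓ : 2 ≤ ℓ) :
    ∃ K : ℝ, 0 < K ∧ ∀ q : ℝ, -1 ≤ q → q < 1 → ∀ (N : ℕ) (R : ℝ), 0 < R →
      m.real {x | ∃ w, w.length ≤ N ∧ R * m.real (c.listCube w) ≤ m.real (c.listCube w) ^ (1 - q) *
        ((ℓ : ℝ) ^ (-lqSpectrum D ℓ m (1 - q))) ^ w.length ∧ x ∈ c.listCube w} ≤ K / R := by
  have := hm.isProbabilityMeasure
  obtain ⟨C, hC, h⟩ := hm.exists_listCube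
  have hC0 : 0 < C := by linarith
  -- Three factors `C ^ (1 - q)` are lost: in splitting off a word, and in bounding the normalized
  -- total sum from below and from above. The condition `-1 ≤ q` bounds each by `C ^ 2`, uniformly
  -- in `q`.
  refine ⟨(C ^ (2 : ℝ)) ^ 3, by positivity, fun q hq0 hq1 N R hR => ?_⟩
  have hq : 0 < 1 - q := by linarith
  have hℓ0 : (0 : ℝ) < ℓ := by positivity
  set E : ℝ := C ^ (1 - q) with hE
  have hE0 : 0 < E := by positivity
  set r : ℝ := (ℓ : ℝ) ^ (-lqSpectrum D ℓ m (1 - q)) with hr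
  have hr0 : 0 < r := by positivity
  set φ : List (Fin (ℓ ^ D)) → ℝ := fun w => m.real (c.listCube w) ^ (1 - q) * r ^ w.length with hφ
  have hφ0 : ∀ w, 0 ≤ φ w := fun w =>
    mul_nonneg (Real.rpow_nonneg measureReal_nonneg _) (by positivity)
  have hmul : ∀ w v, E⁻¹ * (φ w * φ v) ≤ φ (w ++ v) := fun w v => by
    simp only [hφ, List.length_append, pow_add]
    calc _ = E⁻¹ * (m.real (c.listCube w) ^ (1 - q) * m.real (c.listCube v) ^ (1 - q)) *
          (r ^ w.length * r ^ v.length) := by ring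
      _ ≤ _ := mul_le_mul_of_nonneg_right (rpow_listCube hC h hq.le w v).1 (by positivity)
  have hroot : ∀ p, E⁻¹ ≤ treeSum φ p [] ∧ treeSum φ p [] ≤ E := by
    intro p
    have h1 := hm.abs_log_treeSum_sub_le hℓ hC h hq p
    have hpos := hm.treeSum_rpow_pos (by omega) p (1 - q)
    have h2 : treeSum φ p [] =
        treeSum (fun w => m.real (c.listCube w) ^ (1 - q)) p [] * r ^ p := by
      rw [hφ, treeSum_mul_pow_length]; simp
    have h3 : Real.log (treeSum φ p []) =
        Real.log (treeSum (fun w => m.real (c.listCube w) ^ (1 - q)) p []) -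
          p * (lqSpectrum D ℓ m (1 - q) * Real.log ℓ) := by
      rw [h2, Real.log_mul hpos.ne' (by positivity), Real.log_pow, hr, Real.log_rpow hℓ0]
      ring
    have h4 : 0 < treeSum φ p [] := by rw [h2]; positivity
    rw [← h3, abs_le, ← Real.log_inv, Real.log_le_log_iff (by positivity) h4,
      Real.log_le_log_iff h4 hE0] at h1
    exact h1
  have hmax := measureReal_iUnion_le_treeSum m c.listCube_append_subset hφ0
    (κ := E ^ 2 / R) (by positivity) (G := {w | R * m.real (c.listCube w) ≤ φ w})
    (fun w hw p => ?_) N []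
  · refine le_trans (by simpa using hmax) ?_
    calc E ^ 2 / R * treeSum φ N [] ≤ E ^ 2 / R * E := by gcongr; exact (hroot N).2
      _ = E ^ 3 / R := by ring
      _ ≤ _ := by
        gcongr
        exact Real.rpow_le_rpow_of_exponent_le hC (by linarith)
  · have h1 := le_treeSum_append hmul p w []
    rw [List.append_nil] at h1
    have h2 : E⁻¹ * (φ w * E⁻¹) ≤ treeSum φ p w :=
      le_trans (mul_le_mul_of_nonneg_left (mul_le_mul_of_nonneg_left (hroot p).1 (hφ0 w))
        (by positivity)) h1
    have h3 : R * m.real (c.listCube w) ≤ φ w := hw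
    calc m.real (c.listCube w) = R * m.real (c.listCube w) / R := by field_simp
      _ ≤ φ w / R := by gcongr
      _ = E ^ 2 / R * (E⁻¹ * (φ w * E⁻¹)) := by field_simp
      _ ≤ _ := by gcongr

end IsQuasiBernoulli

end Cubes

/-! ### The law of the iterated logarithm for the masses of the cubes -/

section LIL

/-- The exponent obtained in the Chernoff bound, after optimization in `q`. -/
theorem chernoff_exponent_le {s₁ s₂ N n G LL A y d T e : ℝ} (hs₁ : 0 < s₁) (hN : 0 < N)
    (hnN : n ≤ N) (hn : 0 ≤ n) (hG0 : 0 ≤ G) (hG : G ^ 2 = 2 * N * LL) (he : e ^ 2 = 1)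
    (hA : s₂ * G ≤ A) (hy : A ≤ e * (-y - n * d))
    (hT : T ≤ e * (G / (N * s₁)) * d + s₁ ^ 2 / 2 * (e * (G / (N * s₁))) ^ 2) :
    (2 * s₂ / s₁ - 1) * LL ≤ -(e * (G / (N * s₁))) * y - n * T := by
  set q := G / (N * s₁) with hq
  have hq0 : 0 ≤ q := by positivity
  have h1 : n * T ≤ n * (e * q * d) + N * (s₁ ^ 2 / 2 * q ^ 2) := by
    have hq2 : (e * q) ^ 2 = q ^ 2 := by rw [mul_pow, he, one_mul]
    rw [hq2] at hT
    -- Only the quadratic term passes from `n` to the block end `N`; the terms in `d`, whose sign is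
    -- unknown, cancel exactly.
    have h2 : n * (s₁ ^ 2 / 2 * q ^ 2) ≤ N * (s₁ ^ 2 / 2 * q ^ 2) := by gcongr
    nlinarith [mul_le_mul_of_nonneg_left hT hn]
  have h2 : q * (s₂ * G) ≤ q * (e * (-y - n * d)) :=
    mul_le_mul_of_nonneg_left (hA.trans hy) hq0
  have h3 : q * (s₂ * G) - N * (s₁ ^ 2 / 2 * q ^ 2) = (2 * s₂ / s₁ - 1) * LL := by
    have : LL = G ^ 2 / (2 * N) := by rw [hG]; field_simp
    rw [this, hq]
    field_simp
  calc (2 * s₂ / s₁ - 1) * LL = q * (s₂ * G) - N * (s₁ ^ 2 / 2 * q ^ 2) := h3.symm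
    _ ≤ q * (e * (-y - n * d)) - N * (s₁ ^ 2 / 2 * q ^ 2) := by linarith
    _ ≤ _ := by linarith

/-- A block form of Borel–Cantelli: it suffices to sum over geometric blocks of lengths. -/
theorem ae_forall_length_ge_of_blocks {X A : Type*} [MeasurableSpace X] (μ : Measure X)
    [IsFiniteMeasure μ] {ρ : ℝ} (hρ : 1 < ρ) (I : List A → Set X) (P : List A → Prop)
    {u : ℕ → ℝ} (hu : Summable u)
    (h : ∀ᶠ k : ℕ in atTop, μ.real {x | ∃ w : List A, ρ ^ k ≤ w.length ∧
      (w.length : ℝ) ≤ ρ ^ (k + 1) ∧ ¬ P w ∧ x ∈ I w} ≤ u k) :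
    ∀ᵐ x ∂μ, ∃ n₀ : ℕ, ∀ w : List A, n₀ ≤ w.length → x ∈ I w → P w := by
  set B : ℕ → Set X := fun k => {x | ∃ w : List A, ρ ^ k ≤ w.length ∧
      (w.length : ℝ) ≤ ρ ^ (k + 1) ∧ ¬ P w ∧ x ∈ I w} with hB
  have hsum : Summable fun k => μ.real (B k) :=
    hu.of_norm_bounded_eventually_nat (h.mono fun k hk => by
      rwa [Real.norm_of_nonneg measureReal_nonneg])
  have hfin : ∑' k, μ (B k) ≠ ∞ := by
    have := hsum.tsum_ofReal_ne_top
    simpa using this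
  filter_upwards [ae_eventually_notMem hfin] with x hx
  obtain ⟨k₁, hk₁⟩ := eventually_atTop.1 hx
  refine ⟨⌈ρ ^ k₁⌉₊, fun w hw hxw => ?_⟩
  have hw' : ρ ^ k₁ ≤ w.length := Nat.ceil_le.1 hw
  obtain ⟨k, hk, hk'⟩ := exists_nat_pow_near ((one_le_pow₀ hρ.le).trans hw') hρ
  have hlt : k₁ < k + 1 := (pow_lt_pow_iff_right₀ hρ).1 (hw'.trans_lt hk')
  by_contra hP
  exact hk₁ k (by omega) ⟨w, hk, hk'.le, hP, hxw⟩

variable {D ℓ : ℕ} {c : CubeCoding D ℓ} {m : Measure (EuclideanSpace ℝ (Fin D))}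

/-- On a block ending at `N = ρ ^ (k + 1)`, a word violating the bound makes the quasi-martingale
with `q = e · rate(N) / (N s₁)` at least `(log_ℓ N) ^ β`. The maximal inequality bounds the bad
event by a constant times `(k + 1) ^ (-β)`, with `β > 1`. The sign `e` selects the direction of the
deviation. -/
theorem IsQuasiBernoulli.ae_lil_one_sided (hm : IsQuasiBernoulli c m) (hℓ : 2 ≤ ℓ) {d σ s : ℝ}
    (hσ : 0 ≤ σ) (hs : σ < s)
    (hτ : (fun q : ℝ => lqSpectrum D ℓ m (1 - q) - (q * d + σ ^ 2 / 2 * q ^ 2))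
      =o[𝓝 0] fun q : ℝ => q ^ 2) {e : ℝ} (he : |e| = 1) :
    ∀ᵐ x ∂m, ∃ n₀ : ℕ, ∀ w, n₀ ≤ w.length → x ∈ c.listCube w →
      0 < m.real (c.listCube w) ∧
      e * (-Real.logb ℓ (m.real (c.listCube w)) - w.length * d) ≤ s * lilRate ℓ w.length := by
  have := hm.isProbabilityMeasure
  -- In `σ < s₁ < s₂ < s`, the first gap absorbs the `o(q²)` and keeps `s₁` positive when `σ = 0`,
  -- the second gives `β > 1`, and the third absorbs the variation of the rate within a block.
  obtain ⟨s₂, hσs₂, hs₂⟩ := exists_between hs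
  obtain ⟨s₁, hs₁, hs₁₂⟩ := exists_between hσs₂
  have hs₁0 : 0 < s₁ := by linarith
  have hb : (1 : ℝ) < ℓ := by exact_mod_cast hℓ
  have hb0 : (0 : ℝ) < ℓ := by linarith
  have he2 : e ^ 2 = 1 := by rw [← sq_abs, he, one_pow]
  have hτ' : ∃ r > 0, ∀ q : ℝ, |q| < r →
      lqSpectrum D ℓ m (1 - q) ≤ q * d + s₁ ^ 2 / 2 * q ^ 2 := by
    have hc : 0 < (s₁ ^ 2 - σ ^ 2) / 2 := by nlinarith
    obtain ⟨r, hr, h⟩ := Metric.eventually_nhds_iff.1 (hτ.def hc)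
    refine ⟨r, hr, fun q hq => ?_⟩
    have h1 := h (y := q) (by simpa [Real.dist_eq] using hq)
    rw [Real.norm_eq_abs, Real.norm_of_nonneg (sq_nonneg q)] at h1
    nlinarith [(abs_le.1 h1).2]
  obtain ⟨r, hr, hτr⟩ := hτ'
  obtain ⟨ρ, hρ, X, hX⟩ := exists_lilRate_mul_le hb (by linarith : 0 ≤ s₂) hs₂
  obtain ⟨K, hK, hmax⟩ := hm.exists_maximal_le hℓ
  set β : ℝ := 2 * s₂ / s₁ - 1 with hβ
  have hβ1 : 1 < β := by
    have : 1 < s₂ / s₁ := (one_lt_div hs₁0).2 hs₁₂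
    rw [hβ, mul_div_assoc]; linarith
  have hlogρ : 0 < Real.logb ℓ ρ := Real.logb_pos hb hρ
  have hρ0 : 0 < ρ := by linarith
  have hsum : Summable fun k : ℕ => K / ((k + 1 : ℕ) * Real.logb ℓ ρ) ^ β := by
    have h1 := ((summable_nat_add_iff 1).2 (Real.summable_nat_rpow_inv.2 hβ1)).mul_left
      (K / Real.logb ℓ ρ ^ β)
    refine h1.congr fun k => ?_
    rw [Real.mul_rpow (by positivity) hlogρ.le]
    field_simp
  refine ae_forall_length_ge_of_blocks m hρ c.listCube _ hsum ?_
  have hpow : Tendsto (fun k : ℕ => ρ ^ k) atTop atTop := tendsto_pow_atTop_atTop_of_one_lt hρ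
  have hpow' : Tendsto (fun k : ℕ => ρ ^ (k + 1)) atTop atTop := (tendsto_add_atTop_iff_nat 1).2 hpow
  have hmin : 0 < min r 1 * s₁ := by positivity
  filter_upwards [hpow.eventually_ge_atTop X,
    hpow'.eventually ((tendsto_lilRate_div_self hb).eventually (gt_mem_nhds hmin)),
    hpow'.eventually ((tendsto_logb_logb_atTop hb).eventually_ge_atTop 0)] with k hkX hkq hkLL
  set N : ℝ := ρ ^ (k + 1) with hN
  have hN0 : 0 < N := by positivity
  set G : ℝ := lilRate ℓ N with hG
  have hlogN : Real.logb ℓ N = (k + 1 : ℕ) * Real.logb ℓ ρ := by rw [hN, Real.logb_pow]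
  have hlogN0 : 0 < Real.logb ℓ N := by rw [hlogN]; positivity
  have hqlt : G / (N * s₁) < min r 1 := by
    rw [← div_div, div_lt_iff₀ hs₁0]
    exact hkq
  have hq0 : 0 ≤ G / (N * s₁) := div_nonneg (lilRate_nonneg _ _) (by positivity)
  have hqabs : |e * (G / (N * s₁))| < min r 1 := by
    rwa [abs_mul, he, one_mul, abs_of_nonneg hq0]
  have hq1 := abs_lt.1 (hqabs.trans_le (min_le_right _ _))
  have hqr := hqabs.trans_le (min_le_left r 1)
  have hR : 0 < Real.logb ℓ N ^ β := Real.rpow_pos_of_pos hlogN0 _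
  rw [← hlogN]
  refine (measureReal_mono ?_).trans (hmax _ hq1.1.le hq1.2 ⌊N⌋₊ _ hR)
  rintro x ⟨w, hw1, hw2, hbad, hx⟩
  refine ⟨w, Nat.le_floor hw2, ?_, hx⟩
  set μ : ℝ := m.real (c.listCube w) with hμ
  set n : ℝ := (w.length : ℝ) with hn
  set T := lqSpectrum D ℓ m (1 - e * (G / (N * s₁))) with hT
  have hμ0 : 0 ≤ μ := measureReal_nonneg
  -- Words of mass zero also count as bad; for them the threshold inequality is trivial.
  rcases hμ0.eq_or_lt with h0 | h0
  · rw [← h0, mul_zero]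
    positivity
  have hy : s * lilRate ℓ n ≤ e * (-Real.logb ℓ μ - n * d) := by
    by_contra hcon
    exact hbad ⟨h0, (not_le.1 hcon).le⟩
  have hA : s₂ * G ≤ s * lilRate ℓ n := by
    refine hX n (hkX.trans hw1) N hw2 ?_
    rw [hN, pow_succ']
    gcongr
  have hexp := chernoff_exponent_le hs₁0 hN0 hw2 (Nat.cast_nonneg _) (lilRate_nonneg _ _)
    (lilRate_sq hN0.le hkLL) he2 hA hy (hτr _ hqr)
  rw [← hβ] at hexp
  have hRe : Real.logb ℓ N ^ β = (ℓ : ℝ) ^ (β * Real.logb ℓ (Real.logb ℓ N)) := by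
    rw [mul_comm, Real.rpow_mul hb0.le, Real.rpow_logb hb0 hb.ne' hlogN0]
  have hμe : μ = (ℓ : ℝ) ^ Real.logb ℓ μ := (Real.rpow_logb hb0 hb.ne' h0).symm
  generalize Real.logb ℓ μ = y at hexp hμe
  rw [hRe, hμe, ← Real.rpow_natCast, ← Real.rpow_mul hb0.le, ← Real.rpow_mul hb0.le,
    ← Real.rpow_add hb0, ← Real.rpow_add hb0]
  refine Real.rpow_le_rpow_of_exponent_le hb.le ?_
  rw [← hn]
  linarith

theorem measurableSet_unitCube (D : ℕ) :
    MeasurableSet {x : EuclideanSpace ℝ (Fin D) | ∀ i, 0 ≤ x i ∧ x i < 1} := by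
  simp only [Set.ofPred_and, Set.ofPred_forall]
  exact MeasurableSet.iInter fun i => (measurableSet_le measurable_const (by fun_prop)).inter
    (measurableSet_lt (by fun_prop) measurable_const)

/-- The points of the unit cube such that, from generation `n₀` on, the cubes containing them
obey the law of the iterated logarithm with constant `s`. -/
def lilSet (ℓ : ℕ) (m : Measure (EuclideanSpace ℝ (Fin D))) (d s : ℝ) (n₀ : ℕ) :
    Set (EuclideanSpace ℝ (Fin D)) :=
  {x | (∀ i, 0 ≤ x i ∧ x i < 1) ∧ ∀ n ≥ n₀, ∀ k, x ∈ adicCube D ℓ n k →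
    0 < m.real (adicCube D ℓ n k) ∧
    |Real.logb ℓ (m.real (adicCube D ℓ n k)) + n * d| ≤ s * lilRate ℓ n}

theorem measurableSet_lilSet (m : Measure (EuclideanSpace ℝ (Fin D))) (d s : ℝ) (n₀ : ℕ) :
    MeasurableSet (lilSet ℓ m d s n₀) := by
  simp only [lilSet, Set.ofPred_and (p := fun x : EuclideanSpace ℝ (Fin D) => ∀ i, 0 ≤ x i ∧ x i < 1)]
  refine MeasurableSet.inter (measurableSet_unitCube D) ?_
  simp only [Set.ofPred_forall]
  refine MeasurableSet.iInter fun n => MeasurableSet.iInter fun _ =>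
    MeasurableSet.iInter fun k => ?_
  exact (measurableSet_adicCube D ℓ n k).imp (MeasurableSet.const _)

theorem IsQuasiBernoulli.ae_exists_mem_lilSet (hm : IsQuasiBernoulli c m) (hℓ : 2 ≤ ℓ)
    {d σ s : ℝ} (hσ : 0 ≤ σ) (hs : σ < s)
    (hτ : (fun q : ℝ => lqSpectrum D ℓ m (1 - q) - (q * d + σ ^ 2 / 2 * q ^ 2))
      =o[𝓝 0] fun q : ℝ => q ^ 2) :
    ∀ᵐ x ∂m, ∃ n₀ : ℕ, x ∈ lilSet ℓ m d s n₀ := by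
  have := hm.isProbabilityMeasure
  have hQ : ∀ᵐ x ∂m, ∀ i, 0 ≤ x i ∧ x i < 1 := by
    exact (mem_ae_iff_prob_eq_one₀ (measurableSet_unitCube D).nullMeasurableSet).2 hm.unitCube
  filter_upwards [hQ, hm.ae_lil_one_sided hℓ hσ hs hτ (e := 1) (by simp),
    hm.ae_lil_one_sided hℓ hσ hs hτ (e := -1) (by simp)] with x hxQ ⟨n₁, h₁⟩ ⟨n₂, h₂⟩
  refine ⟨max n₁ n₂, hxQ, fun n hn k hk => ?_⟩
  obtain ⟨w, hw, hwk⟩ := c.exists_listCube_eq k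
  have g₁ := h₁ w (by rw [hw]; exact (le_max_left _ _).trans hn) (hwk ▸ hk)
  have g₂ := h₂ w (by rw [hw]; exact (le_max_right _ _).trans hn) (hwk ▸ hk)
  rw [hwk, hw] at g₁ g₂
  exact ⟨g₁.1, abs_le.2 ⟨by linarith [g₁.2], by linarith [g₂.2]⟩⟩

end LIL

/-! ### Comparison of cubes with sets of small diameter and with balls -/

section Geometry

variable {D ℓ : ℕ}

theorem abs_sub_le_one_of_mem_adicCube (hℓ : 0 < ℓ) {n : ℕ} {k k' : Fin D → Fin (ℓ ^ n)}
    {x y : EuclideanSpace ℝ (Fin D)} (hx : x ∈ adicCube D ℓ n k) (hy : y ∈ adicCube D ℓ n k')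
    (hxy : dist x y ≤ ((ℓ : ℝ) ^ n)⁻¹) (i : Fin D) :
    ((k i : ℕ) : ℤ) ∈ Finset.Icc (((k' i : ℕ) : ℤ) - 1) (((k' i : ℕ) : ℤ) + 1) := by
  have hpow : (0 : ℝ) < (ℓ : ℝ) ^ n := by positivity
  have h1 : |x i - y i| ≤ ((ℓ : ℝ) ^ n)⁻¹ := by
    rw [← Real.dist_eq]
    exact (PiLp.dist_apply_le x y i).trans hxy
  obtain ⟨h2, h3⟩ := abs_le.1 h1
  obtain ⟨a1, a2⟩ := hx i
  obtain ⟨b1, b2⟩ := hy i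
  have e1 : ((k i : ℕ) : ℝ) < (k' i : ℕ) + 2 := by
    have : ((k i : ℕ) : ℝ) / (ℓ : ℝ) ^ n < ((k' i : ℕ) + 2) / (ℓ : ℝ) ^ n := by
      have : (((k' i : ℕ) : ℝ) + 2) / (ℓ : ℝ) ^ n =
        (((k' i : ℕ) : ℝ) + 1) / (ℓ : ℝ) ^ n + ((ℓ : ℝ) ^ n)⁻¹ := by ring
      linarith
    exact (div_lt_div_iff_of_pos_right hpow).1 this
  have e2 : ((k' i : ℕ) : ℝ) < (k i : ℕ) + 2 := by
    have : ((k' i : ℕ) : ℝ) / (ℓ : ℝ) ^ n < ((k i : ℕ) + 2) / (ℓ : ℝ) ^ n := by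
      have : (((k i : ℕ) : ℝ) + 2) / (ℓ : ℝ) ^ n =
        (((k i : ℕ) : ℝ) + 1) / (ℓ : ℝ) ^ n + ((ℓ : ℝ) ^ n)⁻¹ := by ring
      linarith
    exact (div_lt_div_iff_of_pos_right hpow).1 this
  have e1' : (k i : ℕ) < (k' i : ℕ) + 2 := by exact_mod_cast e1
  have e2' : (k' i : ℕ) < (k i : ℕ) + 2 := by exact_mod_cast e2
  rw [Finset.mem_Icc]
  omega

theorem dist_le_of_mem_adicCube {n : ℕ} {k : Fin D → Fin (ℓ ^ n)}
    {x y : EuclideanSpace ℝ (Fin D)} (hx : x ∈ adicCube D ℓ n k) (hy : y ∈ adicCube D ℓ n k) :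
    dist x y ≤ D * ((ℓ : ℝ) ^ n)⁻¹ := by
  rw [EuclideanSpace.dist_eq]
  refine Real.sqrt_le_iff.2 ⟨by positivity, ?_⟩
  have h1 : ∀ i, dist (x i) (y i) ≤ ((ℓ : ℝ) ^ n)⁻¹ := fun i => by
    obtain ⟨a1, a2⟩ := hx i
    obtain ⟨b1, b2⟩ := hy i
    have : (((k i : ℕ) : ℝ) + 1) / (ℓ : ℝ) ^ n =
      ((k i : ℕ) : ℝ) / (ℓ : ℝ) ^ n + ((ℓ : ℝ) ^ n)⁻¹ := by ring
    rw [Real.dist_eq, abs_le]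
    constructor <;> linarith
  calc ∑ i, dist (x i) (y i) ^ 2 ≤ ∑ _i : Fin D, (((ℓ : ℝ) ^ n)⁻¹) ^ 2 :=
        Finset.sum_le_sum fun i _ => pow_le_pow_left₀ dist_nonneg (h1 i) 2
    _ = D * (((ℓ : ℝ) ^ n)⁻¹) ^ 2 := by simp
    _ ≤ (D * ((ℓ : ℝ) ^ n)⁻¹) ^ 2 := by
        rw [mul_pow]
        gcongr
        exact_mod_cast Nat.le_self_pow two_ne_zero D

variable {m : Measure (EuclideanSpace ℝ (Fin D))} {d s : ℝ} {n₀ : ℕ}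

/-- Only cubes that themselves meet `U ∩ lilSet` are needed to cover it, so each obeys the mass
bound and no control of other neighbours is required. -/
theorem measureReal_inter_lilSet_le [IsFiniteMeasure m] (hℓ : 2 ≤ ℓ) {n : ℕ} (hn : n₀ ≤ n)
    {U : Set (EuclideanSpace ℝ (Fin D))} (hU : ∀ x ∈ U, ∀ y ∈ U, dist x y ≤ ((ℓ : ℝ) ^ n)⁻¹) :
    m.real (U ∩ lilSet ℓ m d s n₀) ≤ 3 ^ D * (ℓ : ℝ) ^ (-(n * d) + s * lilRate ℓ n) := by
  classical
  have hb : (1 : ℝ) < ℓ := by exact_mod_cast hℓ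
  have hb0 : (0 : ℝ) < ℓ := by linarith
  rcases (U ∩ lilSet ℓ m d s n₀).eq_empty_or_nonempty with hem | ⟨y, hyU, hy⟩
  · rw [hem, measureReal_empty]
    positivity
  obtain ⟨k', hk'⟩ := exists_mem_adicCube (ℓ := ℓ) (by omega) n hy.1
  set F : Finset (Fin D → Fin (ℓ ^ n)) :=
    Finset.univ.filter fun k => ∃ x ∈ U ∩ lilSet ℓ m d s n₀, x ∈ adicCube D ℓ n k with hF
  have hcard : F.card ≤ 3 ^ D := by
    have h1 : (Fintype.piFinset fun i : Fin D =>
        Finset.Icc (((k' i : ℕ) : ℤ) - 1) (((k' i : ℕ) : ℤ) + 1)).card = 3 ^ D := by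
      have : ∀ a : ℤ, a + 1 + 1 - (a - 1) = 3 := fun a => by ring
      simp [this]
    rw [← h1]
    refine Finset.card_le_card_of_injOn (fun k i => ((k i : ℕ) : ℤ)) (fun k hk => ?_) ?_
    · obtain ⟨x, hx, hxk⟩ := (Finset.mem_filter.1 hk).2
      simp only [Finset.mem_coe, Fintype.mem_piFinset]
      exact abs_sub_le_one_of_mem_adicCube (by omega) hxk hk' (hU x hx.1 y hyU)
    · intro k₁ _ k₂ _ h
      ext i
      simpa using congrFun h i
  have hsub : U ∩ lilSet ℓ m d s n₀ ⊆ ⋃ k ∈ F, adicCube D ℓ n k := fun x hx => by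
    obtain ⟨k, hk⟩ := exists_mem_adicCube (ℓ := ℓ) (by omega) n hx.2.1
    exact Set.mem_biUnion (Finset.mem_filter.2 ⟨Finset.mem_univ _, x, hx, hk⟩) hk
  have hle : ∀ k ∈ F, m.real (adicCube D ℓ n k) ≤
      (ℓ : ℝ) ^ (-(n * d) + s * lilRate ℓ n) := fun k hk => by
    obtain ⟨x, hx, hxk⟩ := (Finset.mem_filter.1 hk).2
    obtain ⟨h1, h2⟩ := hx.2.2 n hn k hxk
    rw [← Real.logb_le_iff_le_rpow hb h1]
    linarith [(abs_le.1 h2).2]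
  calc m.real (U ∩ lilSet ℓ m d s n₀) ≤ m.real (⋃ k ∈ F, adicCube D ℓ n k) :=
        measureReal_mono hsub (measure_ne_top m _)
    _ ≤ ∑ k ∈ F, m.real (adicCube D ℓ n k) := measureReal_biUnion_finset_le _ _
    _ ≤ F.card • (ℓ : ℝ) ^ (-(n * d) + s * lilRate ℓ n) := Finset.sum_le_card_nsmul _ _ _ hle
    _ ≤ _ := by
      rw [nsmul_eq_mul]
      gcongr
      exact_mod_cast hcard

/-! ### The gauges -/

/-- The variable `log_ℓ (1/t)` acts as a real-valued generation: in it, the gauges take the same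
form as the bounds on cube masses. -/
theorem gauge_eq_rpow (hℓ : 2 ≤ ℓ) (d a : ℝ) {t : ℝ} (ht : 0 < t) :
    t ^ d * lilTheta ℓ t ^ a =
      (ℓ : ℝ) ^ (-(Real.logb ℓ (1 / t) * d) + a * lilRate ℓ (Real.logb ℓ (1 / t))) := by
  have hb : (1 : ℝ) < ℓ := by exact_mod_cast hℓ
  have hb0 : (0 : ℝ) < ℓ := by linarith
  have h1 : t = (ℓ : ℝ) ^ (-Real.logb ℓ (1 / t)) := by
    rw [one_div, Real.logb_inv, neg_neg, Real.rpow_logb hb0 hb.ne' ht]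
  have h2 : lilTheta ℓ t = (ℓ : ℝ) ^ lilRate ℓ (Real.logb ℓ (1 / t)) := rfl
  rw [h2, Real.rpow_add hb0, ← Real.rpow_mul hb0.le, mul_comm a]
  congr 1
  conv_lhs => rw [h1]
  rw [← Real.rpow_mul hb0.le]
  congr 1
  ring

theorem le_logb_one_div {b M t : ℝ} (hb : 1 < b) (ht : 0 < t) (h : t ≤ b ^ (-M)) :
    M ≤ Real.logb b (1 / t) := by
  have hb0 : 0 < b := by linarith
  rw [one_div, Real.logb_inv, le_neg, Real.logb_le_iff_le_rpow hb ht]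
  exact h

theorem exists_measureReal_inter_lilSet_le_gauge [IsFiniteMeasure m] (hℓ : 2 ≤ ℓ) (hs : 0 ≤ s)
    (n₀ : ℕ) : ∃ t₀ > 0, ∀ t, 0 < t → t ≤ t₀ → ∀ U : Set (EuclideanSpace ℝ (Fin D)),
      (∀ x ∈ U, ∀ y ∈ U, dist x y ≤ t) →
      m.real (U ∩ lilSet ℓ m d s n₀) ≤
        3 ^ D * (ℓ : ℝ) ^ |d| * (t ^ d * lilTheta ℓ t ^ s) := by
  have hb : (1 : ℝ) < ℓ := by exact_mod_cast hℓ
  have hb0 : (0 : ℝ) < ℓ := by linarith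
  -- The generation `⌊x⌋₊` must be at least `n₀` for the mass bound and at least `ℓ` for
  -- `lilRate_mono`. Rounding down costs at most the factor `ℓ ^ |d|`.
  refine ⟨(ℓ : ℝ) ^ (-((max ℓ n₀ : ℕ) : ℝ)), by positivity, fun t ht ht₀ U hU => ?_⟩
  have hM := le_logb_one_div hb ht ht₀
  rw [gauge_eq_rpow hℓ d s ht]
  have ht' : t = (ℓ : ℝ) ^ (-Real.logb ℓ (1 / t)) := by
    rw [one_div, Real.logb_inv, neg_neg, Real.rpow_logb hb0 hb.ne' ht]
  generalize Real.logb ℓ (1 / t) = x at hM ht'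
  have hx0 : 0 ≤ x := (Nat.cast_nonneg _).trans hM
  have hn : max ℓ n₀ ≤ ⌊x⌋₊ := Nat.le_floor hM
  have hnx : (⌊x⌋₊ : ℝ) ≤ x := Nat.floor_le hx0
  have hxn : x < ⌊x⌋₊ + 1 := Nat.lt_floor_add_one x
  have htn : t ≤ ((ℓ : ℝ) ^ ⌊x⌋₊)⁻¹ := by
    rw [ht', ← Real.rpow_natCast, ← Real.rpow_neg hb0.le]
    exact Real.rpow_le_rpow_of_exponent_le hb.le (by linarith)
  refine (measureReal_inter_lilSet_le hℓ ((le_max_right _ _).trans hn)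
    fun x hx y hy => (hU x hx y hy).trans htn).trans ?_
  rw [mul_assoc, ← Real.rpow_add hb0]
  gcongr 3 ^ D * ?_
  refine Real.rpow_le_rpow_of_exponent_le hb.le ?_
  have hg : lilRate ℓ ⌊x⌋₊ ≤ lilRate ℓ x :=
    lilRate_mono hb (by exact_mod_cast (le_max_left _ _).trans hn) hnx
  have h1 : s * lilRate ℓ ⌊x⌋₊ ≤ s * lilRate ℓ x := mul_le_mul_of_nonneg_left hg hs
  have h2 : (x - ⌊x⌋₊) * d ≤ |d| :=
    calc (x - ⌊x⌋₊) * d ≤ |(x - ⌊x⌋₊) * d| := le_abs_self _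
      _ = (x - ⌊x⌋₊) * |d| := by rw [abs_mul, abs_of_nonneg (by linarith)]
      _ ≤ 1 * |d| := by gcongr; linarith
      _ = |d| := one_mul _
  linarith

/-- The gap `a - s` gains a factor exponential in the rate, which tends to infinity; it beats both
the bounded change of generation and the constant `η`. -/
theorem exists_gauge_le_measureReal_closedBall [IsFiniteMeasure m] (hℓ : 2 ≤ ℓ) (hs : 0 ≤ s)
    {a : ℝ} (ha : s < a) (n₀ : ℕ) {η : ℝ} (hη : 0 < η) :
    ∃ δ > 0, ∀ x ∈ lilSet ℓ m d s n₀, ∀ r, 0 < r → r ≤ δ →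
      (2 * r) ^ d * lilTheta ℓ (2 * r) ^ (-a) ≤ η * m.real (Metric.closedBall x r) := by
  have hb : (1 : ℝ) < ℓ := by exact_mod_cast hℓ
  have hb0 : (0 : ℝ) < ℓ := by linarith
  obtain ⟨s', hs', hs'a⟩ := exists_between ha
  obtain ⟨ρ, hρ, X, hX⟩ := exists_lilRate_mul_le hb hs hs'
  set κ : ℝ := 2 * D + 1 with hκ
  have hκ0 : 0 ≤ κ := by positivity
  have hev : ∀ᶠ y : ℝ in atTop, X ≤ y ∧ (n₀ : ℝ) ≤ y ∧ κ / (ρ - 1) ≤ y ∧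
      (κ * |d| - Real.logb ℓ η) / (a - s') ≤ lilRate ℓ y := by
    filter_upwards [eventually_ge_atTop X, eventually_ge_atTop (n₀ : ℝ),
      eventually_ge_atTop (κ / (ρ - 1)), (tendsto_lilRate_atTop hb).eventually_ge_atTop _]
      with y h1 h2 h3 h4
    exact ⟨h1, h2, h3, h4⟩
  obtain ⟨Y, hY⟩ := eventually_atTop.1 hev
  refine ⟨(ℓ : ℝ) ^ (-Y) / 2, by positivity, fun x hx r hr hrδ => ?_⟩
  have h2r : 0 < 2 * r := by linarith
  have hM := le_logb_one_div hb h2r (by linarith : 2 * r ≤ (ℓ : ℝ) ^ (-Y))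
  rw [gauge_eq_rpow hℓ d _ h2r]
  have hr' : 2 * r = (ℓ : ℝ) ^ (-Real.logb ℓ (1 / (2 * r))) := by
    rw [one_div, Real.logb_inv, neg_neg, Real.rpow_logb hb0 hb.ne' h2r]
  generalize Real.logb ℓ (1 / (2 * r)) = y at hM hr'
  obtain ⟨h1, h2, h3, h4⟩ := hY y hM
  have hy0 : 0 ≤ y := (Nat.cast_nonneg _).trans h2
  -- The extra `2 * D` generations make the cube fit in the ball: its diameter is at most `D
  -- ℓ^(-n)`, and `2 D ≤ ℓ ^ (2 D)`. The cost `n - y` is at most `κ`.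
  set n : ℕ := ⌈y⌉₊ + 2 * D with hn
  have hyn : y + 2 * D ≤ n := by
    rw [hn]; push_cast; linarith [Nat.le_ceil y]
  have hny : (n : ℝ) ≤ y + κ := by
    rw [hn, hκ]; push_cast; linarith [Nat.ceil_lt_add_one hy0]
  have hnn₀ : n₀ ≤ n := by
    have : (n₀ : ℝ) ≤ n := h2.trans (by linarith [(Nat.cast_nonneg D : (0 : ℝ) ≤ D)])
    exact_mod_cast this
  obtain ⟨k, hk⟩ := exists_mem_adicCube (ℓ := ℓ) (by omega) n hx.1
  obtain ⟨hpos, hlil⟩ := hx.2 n hnn₀ k hk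
  have hball : adicCube D ℓ n k ⊆ Metric.closedBall x r := fun z hz => by
    rw [Metric.mem_closedBall]
    refine (dist_le_of_mem_adicCube hz hk).trans ?_
    have e1 : ((ℓ : ℝ) ^ n)⁻¹ ≤ 2 * r * ((ℓ : ℝ) ^ (2 * D))⁻¹ := by
      rw [hr', ← Real.rpow_natCast, ← Real.rpow_natCast, ← Real.rpow_neg hb0.le,
        ← Real.rpow_neg hb0.le, ← Real.rpow_add hb0]
      refine Real.rpow_le_rpow_of_exponent_le hb.le ?_
      push_cast
      linarith
    have e2 : (2 * D : ℝ) ≤ (ℓ : ℝ) ^ (2 * D) := by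
      exact_mod_cast (Nat.lt_pow_self (n := 2 * D) (by omega : 1 < ℓ)).le
    have e3 : (0 : ℝ) < (ℓ : ℝ) ^ (2 * D) := by positivity
    calc D * ((ℓ : ℝ) ^ n)⁻¹ ≤ D * (2 * r * ((ℓ : ℝ) ^ (2 * D))⁻¹) := by gcongr
      _ = r * (2 * D / (ℓ : ℝ) ^ (2 * D)) := by ring
      _ ≤ r * 1 := by gcongr; exact (div_le_one e3).2 e2
      _ = r := mul_one r
  have hg : s * lilRate ℓ n ≤ s' * lilRate ℓ y := by
    refine hX y h1 n (by linarith [(Nat.cast_nonneg D : (0 : ℝ) ≤ D)]) ?_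
    rw [div_le_iff₀ (by linarith)] at h3
    linarith
  rw [div_le_iff₀ (by linarith)] at h4
  have hd : (n - y) * d ≤ κ * |d| :=
    calc (n - y) * d ≤ |(n - y) * d| := le_abs_self _
      _ = (n - y) * |d| := by
        rw [abs_mul, abs_of_nonneg (by linarith [(Nat.cast_nonneg D : (0 : ℝ) ≤ D)])]
      _ ≤ κ * |d| := by gcongr; linarith
  have hη' : η = (ℓ : ℝ) ^ Real.logb ℓ η := (Real.rpow_logb hb0 hb.ne' hη).symm
  calc (ℓ : ℝ) ^ (-(y * d) + -a * lilRate ℓ y)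
      ≤ (ℓ : ℝ) ^ (Real.logb ℓ η + (-(n * d) - s * lilRate ℓ n)) := by
        refine Real.rpow_le_rpow_of_exponent_le hb.le ?_
        linarith
    _ = η * (ℓ : ℝ) ^ (-(n * d) - s * lilRate ℓ n) := by rw [Real.rpow_add hb0, ← hη']
    _ ≤ η * m.real (adicCube D ℓ n k) := by
        gcongr
        rw [← Real.le_logb_iff_rpow_le hb hpos]
        linarith [(abs_le.1 hlil).1]
    _ ≤ η * m.real (Metric.closedBall x r) :=
        mul_le_mul_of_nonneg_left (measureReal_mono hball (measure_ne_top m _)) hη.le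

end Geometry

/-! ### Absolute continuity and singularity -/

section Conclusion

variable {D ℓ : ℕ} {m : Measure (EuclideanSpace ℝ (Fin D))} {d s : ℝ}

theorem smul_restrict_lilSet_le_hausdorffGaugeMeasure [IsFiniteMeasure m] (hℓ : 2 ≤ ℓ)
    (hs : 0 ≤ s) (n₀ : ℕ) :
    (ENNReal.ofReal (3 ^ D * (ℓ : ℝ) ^ |d|))⁻¹ • m.restrict (lilSet ℓ m d s n₀) ≤
      hausdorffGaugeMeasure fun t : ℝ => t ^ d * lilTheta ℓ t ^ s := by
  obtain ⟨t₀, ht₀, h⟩ := exists_measureReal_inter_lilSet_le_gauge (m := m) (d := d) hℓ hs n₀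
  have hK : 0 < 3 ^ D * (ℓ : ℝ) ^ |d| := by positivity
  have key : ∀ t, 0 < t → t ≤ t₀ → ∀ U : Set (EuclideanSpace ℝ (Fin D)),
      Metric.ediam U ≤ ENNReal.ofReal t →
      (ENNReal.ofReal (3 ^ D * (ℓ : ℝ) ^ |d|))⁻¹ * m (U ∩ lilSet ℓ m d s n₀) ≤
        ENNReal.ofReal (t ^ d * lilTheta ℓ t ^ s) := by
    intro t ht htt₀ U hU
    have h1 := h t ht htt₀ U fun x hx y hy => by
      have := (Metric.edist_le_ediam_of_mem hx hy).trans hU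
      rwa [edist_dist, ENNReal.ofReal_le_ofReal_iff ht.le] at this
    rw [ENNReal.inv_mul_le_iff (by simpa using hK) ENNReal.ofReal_ne_top,
      ← ENNReal.ofReal_mul hK.le]
    exact (ENNReal.le_ofReal_iff_toReal_le (measure_ne_top _ _)
      (le_trans measureReal_nonneg h1)).2 h1
  refine Measure.le_mkMetric _ _ (ENNReal.ofReal t₀) (by simpa using ht₀) fun U hU => ?_
  rw [Measure.smul_apply, smul_eq_mul, Measure.restrict_apply' (measurableSet_lilSet m d s n₀),
    gaugeValue]
  -- A set of diameter `0` satisfies the estimate for every small `t`, hence also for the limsup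
  -- that extends the gauge; no sign of `d` is needed.
  split_ifs with h0
  · refine le_limsup_of_frequently_le' (Eventually.frequently ?_)
    filter_upwards [Ioc_mem_nhdsGT ht₀] with t ht
    exact key t ht.1 ht.2 U (by simp [h0])
  · have htop : Metric.ediam U ≠ ∞ := ne_top_of_le_ne_top ENNReal.ofReal_ne_top hU
    exact key _ (ENNReal.toReal_pos h0 htop) (ENNReal.toReal_le_of_le_ofReal ht₀.le hU) U
      (ENNReal.ofReal_toReal htop).ge

/-- Each ball has gauge at most `η` times its mass, and disjoint balls have total mass at most `1`,
so fine packings have sum at most `η`. -/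
theorem packingPremeasure_lilSet_eq_zero [IsProbabilityMeasure m] (hℓ : 2 ≤ ℓ)
    (hs : 0 ≤ s) {a : ℝ} (ha : s < a) (n₀ : ℕ) :
    packingPremeasure (fun t : ℝ => t ^ d * lilTheta ℓ t ^ (-a)) (lilSet ℓ m d s n₀) = 0 := by
  refine le_antisymm (ENNReal.le_of_forall_pos_le_add fun η hη _ => ?_) bot_le
  rw [zero_add]
  obtain ⟨δ, hδ, h⟩ := exists_gauge_le_measureReal_closedBall (m := m) (d := d) hℓ hs ha n₀
    (η := η) (by exact_mod_cast hη)
  refine iInf₂_le_of_le δ hδ (iSup₂_le fun P hP => ?_)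
  calc ∑' p : P, ENNReal.ofReal ((2 * p.1.2) ^ d * lilTheta ℓ (2 * p.1.2) ^ (-a))
      ≤ ∑' p : P, (η : ℝ≥0∞) * m (Metric.closedBall p.1.1 p.1.2) := by
        refine ENNReal.tsum_le_tsum fun p => ?_
        refine (ENNReal.ofReal_le_ofReal (h _ (hP.center_mem p.1 p.2) _
          (hP.radius_pos p.1 p.2) (hP.radius_le p.1 p.2))).trans (le_of_eq ?_)
        rw [ENNReal.ofReal_mul η.coe_nonneg]
        simp
    _ = η * ∑' p : P, m (Metric.closedBall p.1.1 p.1.2) := ENNReal.tsum_mul_left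
    _ ≤ η * m (⋃ p : P, Metric.closedBall p.1.1 p.1.2) := by
        gcongr
        refine tsum_meas_le_meas_iUnion_of_disjoint m
          (fun p => Metric.isClosed_closedBall.measurableSet) fun p q hpq => ?_
        exact hP.disjoint p.2 q.2 (Subtype.coe_injective.ne hpq)
    _ ≤ η * 1 := by gcongr; exact prob_le_one
    _ = η := mul_one _

theorem packingGaugeMeasure_iUnion_lilSet_eq_zero [IsProbabilityMeasure m] (hℓ : 2 ≤ ℓ)
    (hs : 0 ≤ s) {a : ℝ} (ha : s < a) :
    packingGaugeMeasure (fun t : ℝ => t ^ d * lilTheta ℓ t ^ (-a))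
      (⋃ n₀, lilSet ℓ m d s n₀) = 0 := by
  refine measure_iUnion_null fun n₀ => ?_
  rw [packingGaugeMeasure, toMeasure_apply _ _ (measurableSet_lilSet m d s n₀)]
  refine le_antisymm ((OuterMeasure.ofFunction_le _).trans ?_) bot_le
  exact (packingPremeasure_lilSet_eq_zero hℓ hs ha n₀).le

end Conclusion

theorem mainTheorem6 (D ℓ : ℕ) (hD : 1 ≤ D) (hℓ : 2 ≤ ℓ)
    (c : CubeCoding D ℓ) (m : Measure (EuclideanSpace ℝ (Fin D)))
    (hm : IsQuasiBernoulli c m)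
    (d σ : ℝ) (hd : d = -deriv (lqSpectrum D ℓ m) 1) (hσ : 0 ≤ σ)
    (hτ : (fun q : ℝ => lqSpectrum D ℓ m (1 - q) - (q * d + σ ^ 2 / 2 * q ^ 2))
      =o[𝓝 0] fun q : ℝ => q ^ 2)
    (ε : ℝ) (hε : 0 < ε) :
    m ≪ hausdorffGaugeMeasure (fun t : ℝ => t ^ d * lilTheta ℓ t ^ (σ + ε)) ∧
    m ⟂ₘ packingGaugeMeasure (fun t : ℝ => t ^ d * lilTheta ℓ t ^ (-(σ + ε))) := by
  have := hm.isProbabilityMeasure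
  constructor
  · refine Measure.AbsolutelyContinuous.mk fun A _ hA => ?_
    have hnull : ∀ n₀, m (A ∩ lilSet ℓ m d (σ + ε) n₀) = 0 := fun n₀ => by
      have h := smul_restrict_lilSet_le_hausdorffGaugeMeasure (m := m) (d := d) (s := σ + ε) hℓ
        (by linarith) n₀ A
      rw [hA, Measure.smul_apply, smul_eq_mul,
        Measure.restrict_apply' (measurableSet_lilSet m d _ n₀), nonpos_iff_eq_zero,
        mul_eq_zero] at h
      exact h.resolve_left (ENNReal.inv_ne_zero.2 ENNReal.ofReal_ne_top)
    refine measure_mono_null_ae ?_ (measure_iUnion_null hnull)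
    filter_upwards [hm.ae_exists_mem_lilSet hℓ hσ (by linarith : σ < σ + ε) hτ] with x ⟨n₀, hx⟩ hxA
    exact Set.mem_iUnion.2 ⟨n₀, hxA, hx⟩
  -- Using `ε / 2` leaves the strict gap below `σ + ε` that makes the packing measure vanish.
  · refine ⟨(⋃ n₀, lilSet ℓ m d (σ + ε / 2) n₀)ᶜ,
      (MeasurableSet.iUnion fun n₀ => measurableSet_lilSet m d _ n₀).compl, ?_, ?_⟩
    · filter_upwards [hm.ae_exists_mem_lilSet hℓ hσ (by linarith : σ < σ + ε / 2) hτ] with x hx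
      exact Set.mem_iUnion.2 hx
    · rw [compl_compl]
      exact packingGaugeMeasure_iUnion_lilSet_eq_zero hℓ (by linarith) (by linarith)
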